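/- All functions are on the real line with Lebesgue measure, identities between functions hold almost everywhere, $I$ ranges over the compact intervals of positive length, $u_I=\frac1{|I|}\int_I u\,dx$, and $\inf_I$ is the essential infimum over $I$. A real-valued $f\in L^1_{loc}(\mathbb R)$ belongs to $BLO$ if $\sup_I\,[f_I-\inf_I f]<\infty$. A weight, that is, a locally integrable, almost everywhere positive function $w:\mathbb R\to[0,\infty)$, belongs to the Muckenhoupt class $A_1$ if $\sup_I \frac{w_I}{\inf_I w}<\infty$. For $g\in L^1_{loc}(\mathbb R)$ let $Mg(x)=\sup_{I\ni x}|g|_I\in[0,\infty]$ be the Hardy–Littlewood maximal function, and put $$\|f\|'_{BLO}=\inf\{\alpha+\|b\|_\infty:\ \alpha>0,\ b\in L^\infty(\mathbb R),\ \exists\, g\in L^1_{loc}(\mathbb R)\ \text{with}\ f=\alpha\log(Mg)+b\}$$ (where $\inf\emptyset=\infty$). **Theorem.** For every $f\in BLO$ the quantity $$\sigma(f)=\inf\{\mu>0:\ e^{f/\mu}\in A_1\}$$ is finite, and $$\operatorname{dist}_{BLO'}(f,L^\infty):=\inf_{h\in L^\infty}\|f-h\|'_{BLO}=\sigma(f).$$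 -/

import Mathlib

open MeasureTheory Set
open scoped ENNReal

noncomputable section

/-- The `BLO` norm `sup_I [f_I - inf_I f]` over the compact intervals `I = [a, b]`, `a < b`,
as an extended real; `inf_I` is the essential infimum (which may be `-∞`). -/
def bloNorm (f : ℝ → ℝ) : EReal :=
  ⨆ (a : ℝ) (b : ℝ) (_ : a < b),
    (((⨍ x in Icc a b, f x : ℝ) : EReal) -
      essInf (fun x => (f x : EReal)) (volume.restrict (Icc a b)))

/-- Functions of bounded lower oscillation on the real line. -/
def IsBLO (f : ℝ → ℝ) : Prop :=
  LocallyIntegrable f volume ∧ bloNorm f < ⊤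

/-- The `A₁` constant `sup_I (w_I / inf_I w)` of a nonnegative function; `inf_I` is the
essential infimum. -/
def a1Const (w : ℝ → ℝ) : ℝ≥0∞ :=
  ⨆ (a : ℝ) (b : ℝ) (_ : a < b),
    (⨍⁻ x in Icc a b, ENNReal.ofReal (w x) ∂volume) /
      essInf (fun x => ENNReal.ofReal (w x)) (volume.restrict (Icc a b))

/-- Muckenhoupt `A₁` weights on the real line. (Positivity almost everywhere excludes only the
zero function, for which the quotient defining the constant would read `0 / 0`.) -/
structure IsA1 (w : ℝ → ℝ) : Prop where
  nonneg : ∀ x, 0 ≤ w x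
  ae_pos : ∀ᵐ x, 0 < w x
  locallyIntegrable : LocallyIntegrable w volume
  a1Const_lt_top : a1Const w < ⊤

/-- The (uncentred) Hardy-Littlewood maximal function, with values in `[0, ∞]`. -/
def hlMaximal (g : ℝ → ℝ) (x : ℝ) : ℝ≥0∞ :=
  ⨆ (a : ℝ) (b : ℝ) (_ : a < b) (_ : x ∈ Icc a b), ⨍⁻ t in Icc a b, ‖g t‖ₑ ∂volume

/-- `f = α log (M g) + b` almost everywhere, with `α > 0`, `b ∈ L^∞` and `g ∈ L¹_loc`.
The logarithm takes values in `[-∞, ∞]`, so since `f` and `b` are real valued the identity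
forces `0 < M g < ∞` almost everywhere. -/
structure IsLogMaximalDecomp (f : ℝ → ℝ) (α : ℝ) (b g : ℝ → ℝ) : Prop where
  pos : 0 < α
  memLp : MemLp b ⊤ volume
  locallyIntegrable : LocallyIntegrable g volume
  ae_eq : ∀ᵐ x, (f x : EReal) = (α : EReal) * ENNReal.log (hlMaximal g x) + (b x : EReal)

/-- The new norm: the infimum of `α + ‖b‖_∞` over all decompositions `f = α log (M g) + b`
(`∞` if there is none). -/
def bloNewNorm (f : ℝ → ℝ) : ℝ≥0∞ :=
  ⨅ (α : ℝ) (b : ℝ → ℝ) (g : ℝ → ℝ) (_ : IsLogMaximalDecomp f α b g),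
    ENNReal.ofReal α + eLpNorm b ⊤ volume

/-- The distance from `f` to `L^∞` in the new norm. -/
def distNewLinfty (f : ℝ → ℝ) : ℝ≥0∞ :=
  ⨅ (h : ℝ → ℝ) (_ : MemLp h ⊤ volume), bloNewNorm (f - h)

/-- `σ(f) = inf {μ > 0 : e^{f/μ} ∈ A₁}` (`∞` if there is no such `μ`). -/
def sigmaA1 (f : ℝ → ℝ) : ℝ≥0∞ :=
  ⨅ (μ : ℝ) (_ : 0 < μ) (_ : IsA1 (fun x => Real.exp (f x / μ))), ENNReal.ofReal μ

end

/-! Modulo bounded functions, `f = α log (M g)` says that `e^{f/α}` is comparable to `M g`, so both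
sides of the identity measure the same exponents. If `w = e^{f/μ}` is in `A₁`, then `w ≤ M w ≤ K w`
almost everywhere. Hence `f` differs from `μ log (M w)` by a bounded function, and the distance is
at most `μ` (`IsA1.exists_isLogMaximalDecomp`). Conversely, if `f - h = α log (M g) + b` and `μ >
α`, then `e^{f/μ}` is comparable to `(M g)^{α/μ}`, an `A₁` weight by Coifman-Rochberg
(`IsLogMaximalDecomp.isA1_exp_div`). Letting `μ` decrease to `α` gives `σ(f) ≤ α`. Finiteness of
`σ(f)` is a John-Nirenberg inequality for `BLO` (`IsBLO.exists_isA1_exp`). Coifman-Rochberg and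
John-Nirenberg both come from Vitali coverings and the same tail summation,
`exists_lintegral_le_of_geometric_tail`. -/

/-! ### Tail summation and pointwise forms of `A₁` and `BLO`. -/

lemma setLAverage_Icc_le_iff {a b : ℝ} (hab : a < b) (φ : ℝ → ℝ≥0∞) (c : ℝ≥0∞) :
    ⨍⁻ x in Icc a b, φ x ∂volume ≤ c ↔
      ∫⁻ x in Icc a b, φ x ≤ c * ENNReal.ofReal (b - a) := by
  rw [setLAverage_eq, Real.volume_Icc]
  have h : ENNReal.ofReal (b - a) ≠ 0 := by simpa using hab
  exact ENNReal.div_le_iff_le_mul (Or.inl h) (Or.inl ENNReal.ofReal_ne_top)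

lemma restrict_Icc_ae_neBot {a b : ℝ} (hab : a < b) :
    (ae (volume.restrict (Icc a b))).NeBot := by
  rw [ae_neBot, Ne, Measure.restrict_eq_zero]
  simpa using hab

/-- A function whose superlevel sets at `ρ ^ n` decay like `2⁻ⁿ` with `ρ < 2` has bounded mean. -/
lemma exists_lintegral_le_of_geometric_tail {A ρ : ℝ≥0∞} (hA : A ≠ ⊤) (hρ : 1 < ρ) (hρ2 : ρ < 2) :
    ∃ B : ℝ≥0∞, B ≠ ⊤ ∧ ∀ (ν : Measure ℝ) (v : ℝ → ℝ≥0∞), (∀ᵐ x ∂ν, v x ≠ ⊤) →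
      (∀ n : ℕ, ν {x | ρ ^ n < v x} ≤ A * 2⁻¹ ^ n * ν univ) →
      ∫⁻ x, v x ∂ν ≤ B * ν univ := by
  have hρt : ρ ≠ ⊤ := hρ2.ne_top
  refine ⟨1 + ∑' n : ℕ, ρ * A * (ρ * 2⁻¹) ^ n, ?_, fun ν v hv htail => ?_⟩
  · rw [ENNReal.tsum_mul_left, ENNReal.tsum_geometric]
    refine ENNReal.add_ne_top.2 ⟨by simp, ENNReal.mul_ne_top (ENNReal.mul_ne_top hρt hA) ?_⟩
    refine ENNReal.inv_ne_top.2 (tsub_pos_of_lt ?_).ne'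
    rw [← div_eq_mul_inv]
    exact ENNReal.div_lt_of_lt_mul (by simpa using hρ2)
  -- Measurable hulls, because `v` is not assumed measurable; they have the same measure as the
  -- superlevel sets.
  · set S : ℕ → Set ℝ := fun n => toMeasurable ν {x | ρ ^ n < v x}
    have hS : ∀ n, MeasurableSet (S n) := fun n => measurableSet_toMeasurable _ _
    have hle : ∀ᵐ x ∂ν, v x ≤ 1 + ∑' n, (S n).indicator (fun _ => ρ ^ (n + 1)) x := by
      filter_upwards [hv] with x hx
      have hex : ∃ n : ℕ, v x ≤ ρ ^ n := by
        have := ENNReal.tendsto_pow_atTop_nhds_top_iff.2 hρ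
        exact ((this.eventually (lt_mem_nhds (lt_top_iff_ne_top.2 hx))).exists).imp
          fun n hn => hn.le
      classical
      rcases h : Nat.find hex with _ | n
      · have := Nat.find_spec hex
        rw [h, pow_zero] at this
        exact this.trans le_self_add
      · have h1 := Nat.find_spec hex
        have h2 := Nat.find_min hex (m := n) (by omega)
        rw [h] at h1
        have hmem : x ∈ S n := subset_toMeasurable _ _ (not_le.1 h2)
        calc v x ≤ ρ ^ (n + 1) := h1
          _ = (S n).indicator (fun _ => ρ ^ (n + 1)) x := by simp [hmem]
          _ ≤ ∑' n, (S n).indicator (fun _ => ρ ^ (n + 1)) x :=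
            ENNReal.le_tsum (f := fun n => (S n).indicator (fun _ => ρ ^ (n + 1)) x) n
          _ ≤ _ := le_add_self
    calc ∫⁻ x, v x ∂ν ≤ ∫⁻ x, (1 + ∑' n, (S n).indicator (fun _ => ρ ^ (n + 1)) x) ∂ν :=
          lintegral_mono_ae hle
      _ = ν univ + ∑' n, ρ ^ (n + 1) * ν (S n) := by
          rw [lintegral_add_left measurable_const, lintegral_tsum
            fun n => (measurable_const.indicator (hS n)).aemeasurable]
          simp [lintegral_indicator_const (hS _)]
      _ ≤ ν univ + ∑' n, (ρ * A * (ρ * 2⁻¹) ^ n) * ν univ := by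
          refine add_le_add_right (ENNReal.tsum_le_tsum fun n => ?_) _
          rw [measure_toMeasurable]
          calc _ ≤ ρ ^ (n + 1) * (A * 2⁻¹ ^ n * ν univ) := by gcongr; exact htail n
            _ = _ := by rw [mul_pow]; ring
      _ = _ := by rw [ENNReal.tsum_mul_right, add_mul, one_mul]

/-- A bound by the value at almost every point is a bound by the essential infimum. Local
integrability comes for free: the right side is finite at a single point. -/
lemma isA1_exp_of_lintegral_le {φ : ℝ → ℝ} (hφ : AEMeasurable φ) {K : ℝ≥0∞} (hK : K ≠ ⊤)
    (h : ∀ a b : ℝ, a < b → ∀ᵐ x ∂volume.restrict (Icc a b),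
      ∫⁻ t in Icc a b, ENNReal.ofReal (Real.exp (φ t)) ≤
        K * ENNReal.ofReal (Real.exp (φ x)) * ENNReal.ofReal (b - a)) :
    IsA1 (fun x => Real.exp (φ x)) where
  nonneg x := (Real.exp_pos _).le
  ae_pos := ae_of_all _ fun x => Real.exp_pos _
  locallyIntegrable := by
    rw [locallyIntegrable_iff]
    intro k hk
    obtain ⟨R, hR⟩ := hk.isBounded.subset_closedBall 0
    have hlt : (0 - max R 1 : ℝ) < 0 + max R 1 := by
      have := le_max_right R 1
      linarith
    have hsub : k ⊆ Icc (0 - max R 1) (0 + max R 1) := by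
      rw [← Real.closedBall_eq_Icc]
      exact hR.trans (Metric.closedBall_subset_closedBall (le_max_left _ _))
    refine IntegrableOn.mono_set ⟨?_, ?_⟩ hsub
    · exact (Real.measurable_exp.comp_aemeasurable hφ).aestronglyMeasurable.restrict
    · have := restrict_Icc_ae_neBot hlt
      obtain ⟨x, hx⟩ := (h _ _ hlt).exists
      rw [hasFiniteIntegral_iff_ofReal (ae_of_all _ fun x => (Real.exp_pos _).le)]
      exact hx.trans_lt (ENNReal.mul_lt_top (ENNReal.mul_lt_top hK.lt_top ENNReal.ofReal_lt_top)
        ENNReal.ofReal_lt_top)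
  a1Const_lt_top := by
    refine lt_of_le_of_lt (iSup_le fun a => iSup_le fun b => iSup_le fun hab => ?_)
      (ENNReal.add_lt_top.2 ⟨hK.lt_top, ENNReal.one_lt_top⟩)
    refine ENNReal.div_le_of_le_mul ?_
    -- `K + 1` replaces `K` so that division by the constant is legitimate even if `K = 0`.
    have hK0 : K + 1 ≠ 0 := by simp
    have hKt : K + 1 ≠ ⊤ := by simp [hK]
    rw [mul_comm, ← ENNReal.div_le_iff hK0 hKt]
    refine le_essInf_of_ae_le _ ?_
    filter_upwards [h a b hab] with x hx
    rw [ENNReal.div_le_iff hK0 hKt, setLAverage_Icc_le_iff hab]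
    refine hx.trans ?_
    rw [mul_comm K]
    gcongr
    exact le_self_add

lemma IsA1.exists_setLAverage_le {w : ℝ → ℝ} (hw : IsA1 w) :
    ∃ K : ℝ≥0∞, K ≠ ⊤ ∧ ∀ a b : ℝ, a < b → ∀ᵐ x ∂volume.restrict (Icc a b),
      ⨍⁻ t in Icc a b, ENNReal.ofReal (w t) ∂volume ≤ K * ENNReal.ofReal (w x) := by
  -- The `+ 1` makes the constant nonzero, so the quotient can be cleared without first excluding an
  -- infinite essential infimum.
  refine ⟨a1Const w + 1, ENNReal.add_ne_top.2 ⟨hw.a1Const_lt_top.ne, by simp⟩, fun a b hab => ?_⟩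
  have h1 : (⨍⁻ t in Icc a b, ENNReal.ofReal (w t) ∂volume) /
      essInf (fun x => ENNReal.ofReal (w x)) (volume.restrict (Icc a b)) ≤ a1Const w + 1 :=
    (le_iSup_of_le a (le_iSup₂ (f := fun b (_ : a < b) =>
      (⨍⁻ t in Icc a b, ENNReal.ofReal (w t) ∂volume) /
        essInf (fun x => ENNReal.ofReal (w x)) (volume.restrict (Icc a b))) b hab)).trans
      le_self_add
  rw [ENNReal.div_le_iff_le_mul (Or.inr (by simp [hw.a1Const_lt_top.ne])) (Or.inr (by simp))] at h1
  filter_upwards [ae_essInf_le (f := fun x => ENNReal.ofReal (w x))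
    (μ := volume.restrict (Icc a b))] with x hx
  exact h1.trans (by gcongr)

lemma IsBLO.exists_setAverage_le {f : ℝ → ℝ} (hf : IsBLO f) :
    ∃ C : ℝ, 0 < C ∧ ∀ a b : ℝ, a < b → ∀ᵐ x ∂volume.restrict (Icc a b),
      ⨍ t in Icc a b, f t ≤ f x + C := by
  obtain ⟨C, hC, -⟩ := EReal.lt_iff_exists_real_btwn.1 hf.2
  refine ⟨max C 1, by positivity, fun a b hab => ?_⟩
  have h1 : (((⨍ x in Icc a b, f x : ℝ) : EReal) -
      essInf (fun x => (f x : EReal)) (volume.restrict (Icc a b))) ≤ (C : EReal) :=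
    (le_iSup_of_le a (le_iSup₂ (f := fun b (_ : a < b) =>
      (((⨍ x in Icc a b, f x : ℝ) : EReal) -
        essInf (fun x => (f x : EReal)) (volume.restrict (Icc a b)))) b hab)).trans hC.le
  rw [EReal.sub_le_iff_le_add (Or.inr (EReal.coe_ne_top _)) (Or.inr (EReal.coe_ne_bot _))] at h1
  filter_upwards [ae_essInf_le (f := fun x => (f x : EReal))
    (μ := volume.restrict (Icc a b))] with x hx
  have h2 := h1.trans (add_le_add_right hx (C : EReal))
  rw [← EReal.coe_add, EReal.coe_le_coe_iff] at h2
  linarith [le_max_left C 1]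

/-! ### Vitali selection and the John-Nirenberg inequality for `BLO`. -/

lemma exists_countable_disjoint_closedBall_covering {ι : Type*} (S : Set ι) (c r : ι → ℝ) (R : ℝ)
    (hpos : ∀ i ∈ S, 0 < r i) (hR : ∀ i ∈ S, r i ≤ R) :
    ∃ u ⊆ S, u.Countable ∧ (u.PairwiseDisjoint fun i => Metric.closedBall (c i) (r i)) ∧
      ∀ i ∈ S, ∃ j ∈ u, Metric.closedBall (c i) (r i) ⊆ Metric.closedBall (c j) (5 * r j) := by
  obtain ⟨u, hu, hd, hcov⟩ :=
    Vitali.exists_disjoint_subfamily_covering_enlargement_closedBall S c r R hR 5 (by norm_num)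
  refine ⟨u, hu, hd.countable_of_nonempty_interior fun i hi => ?_, hd, hcov⟩
  exact ⟨c i, Metric.ball_subset_interior_closedBall (Metric.mem_ball_self (hpos i (hu hi)))⟩

lemma setAverage_Icc_eq {a b : ℝ} (hab : a < b) (f : ℝ → ℝ) :
    ⨍ x in Icc a b, f x = (b - a)⁻¹ * ∫ x in Icc a b, f x := by
  rw [setAverage_eq, Measure.real, Real.volume_Icc, ENNReal.toReal_ofReal (by linarith),
    smul_eq_mul]

lemma le_setAverage_Icc {a b c : ℝ} (hab : a < b) {f : ℝ → ℝ} (hf : IntegrableOn f (Icc a b))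
    (h : ∀ᵐ x ∂volume.restrict (Icc a b), c ≤ f x) : c ≤ ⨍ x in Icc a b, f x := by
  have h1 : ∫ _ in Icc a b, c ≤ ∫ x in Icc a b, f x :=
    integral_mono_ae (integrable_const c) hf h
  rw [setAverage_Icc_eq hab, ← div_eq_inv_mul, le_div_iff₀ (by linarith)]
  simpa [Measure.real, hab.le, mul_comm] using h1

/-- With `I = [a, b]` inside `J = [a', b']`, `f ≥ f_J - C` almost everywhere on `J`, hence on `I`,
so `f_J - C ≤ f_I ≤ t`. Thus `(f - t)⁺` is at most the nonnegative function `f - (f_J - C)`, whose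
integral over `J` is `C |J|`. No factor `|J| / |I|` is lost. -/
lemma lintegral_ofReal_sub_le {f : ℝ → ℝ} (hf : LocallyIntegrable f) {C : ℝ}
    (hC : ∀ a b : ℝ, a < b → ∀ᵐ x ∂volume.restrict (Icc a b), ⨍ t in Icc a b, f t ≤ f x + C)
    {a b a' b' t : ℝ} (hab : a < b) (ha : a' ≤ a) (hb : b ≤ b') (ht : ⨍ x in Icc a b, f x ≤ t) :
    ∫⁻ x in Icc a' b', ENNReal.ofReal (f x - t) ≤ ENNReal.ofReal (C * (b' - a')) := by
  have hab' : a' < b' := by linarith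
  set m := ⨍ x in Icc a' b', f x with hm
  have hi : ∀ p q, IntegrableOn f (Icc p q) := fun p q => hf.integrableOn_isCompact isCompact_Icc
  have h1 := hC a' b' hab'
  have h2 : m - C ≤ t := by
    refine (le_setAverage_Icc hab (hi a b) ?_).trans ht
    filter_upwards [ae_restrict_of_ae_restrict_of_subset (Icc_subset_Icc ha hb) h1] with x hx
    linarith
  have hint : Integrable (fun x => f x - (m - C)) (volume.restrict (Icc a' b')) :=
    (hi a' b').sub (integrable_const _)
  calc ∫⁻ x in Icc a' b', ENNReal.ofReal (f x - t)
      ≤ ∫⁻ x in Icc a' b', ENNReal.ofReal (f x - (m - C)) :=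
        lintegral_mono fun x => ENNReal.ofReal_le_ofReal (by linarith)
    _ = ENNReal.ofReal (∫ x in Icc a' b', (f x - (m - C))) := by
        rw [ofReal_integral_eq_lintegral_ofReal hint]
        filter_upwards [h1] with x hx
        simp only [Pi.zero_apply]
        linarith
    _ ≤ _ := by
        refine ENNReal.ofReal_le_ofReal (le_of_eq ?_)
        rw [integral_sub (hi a' b') (integrable_const _)]
        have h3 : ∫ x in Icc a' b', f x = m * (b' - a') := by
          rw [hm, setAverage_Icc_eq hab']
          field_simp [(sub_pos.2 hab').ne']
        rw [h3]
        simp only [integral_const, MeasurableSet.univ, measureReal_restrict_apply, univ_inter,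
          Real.volume_real_Icc_of_le hab'.le, smul_eq_mul]
        ring

/-- Almost every point where `f > t` lies in a dyadic-type stopping ball inside `[a, b]` on which
the mean of `f` is at most `t`, and which has a half-size subball on which the mean exceeds `t`. -/
lemma ae_exists_stopping_ball {f : ℝ → ℝ} (hf : LocallyIntegrable f) {c₀ R t : ℝ} (hR : 0 < R)
    (ht : ⨍ x in Metric.closedBall c₀ R, f x ≤ t) :
    ∀ᵐ x, x ∈ Metric.closedBall c₀ R → t < f x → ∃ c r c' : ℝ, 0 < r ∧ r ≤ R ∧
      x ∈ Metric.closedBall c r ∧ Metric.closedBall c r ⊆ Metric.closedBall c₀ R ∧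
      Metric.closedBall c' (r / 2) ⊆ Metric.closedBall c r ∧
      ⨍ y in Metric.closedBall c r, f y ≤ t ∧ t < ⨍ y in Metric.closedBall c' (r / 2), f y := by
  filter_upwards [IsUnifLocDoublingMeasure.ae_tendsto_average volume hf 1] with x hx hxI hxt
  rw [Metric.mem_closedBall, Real.dist_eq, abs_le] at hxI
  -- Images of the original ball under the homotheties with centre `x` and ratio `2⁻ⁿ`: nested balls
  -- containing `x`. By Lebesgue differentiation some mean exceeds `t`; the ball just before the
  -- first such one is the stopping ball.
  set w : ℕ → ℝ := fun n => x + (1 / 2) ^ n * (c₀ - x) with hw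
  set δ : ℕ → ℝ := fun n => (1 / 2) ^ n * R with hδ
  have hp : ∀ n : ℕ, (0 : ℝ) < (1 / 2) ^ n := fun n => by positivity
  have hp1 : ∀ n : ℕ, ((1 : ℝ) / 2) ^ n ≤ 1 := fun n => pow_le_one₀ (by norm_num) (by norm_num)
  have hδpos : ∀ n, 0 < δ n := fun n => mul_pos (hp n) hR
  have hxmem : ∀ n, x ∈ Metric.closedBall (w n) (δ n) := fun n => by
    rw [Metric.mem_closedBall, Real.dist_eq, abs_le]
    have := hp n
    constructor <;> simp only [hw, hδ] <;> nlinarith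
  have hlim : Filter.Tendsto δ Filter.atTop (nhdsWithin 0 (Ioi 0)) := by
    refine tendsto_nhdsWithin_iff.2 ⟨?_, Filter.Eventually.of_forall hδpos⟩
    have := (tendsto_pow_atTop_nhds_zero_of_lt_one (r := (1 / 2 : ℝ)) (by norm_num)
      (by norm_num)).mul_const R
    rwa [zero_mul] at this
  have hconv := hx w δ hlim (Filter.Eventually.of_forall fun n => by simpa using hxmem n)
  have hex : ∃ n, t < ⨍ y in Metric.closedBall (w n) (δ n), f y :=
    (hconv.eventually (lt_mem_nhds hxt)).exists
  classical
  have hspec := Nat.find_spec hex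
  rcases h : Nat.find hex with _ | n
  · rw [h] at hspec
    simp only [hw, hδ, pow_zero, one_mul, add_sub_cancel] at hspec
    exact absurd hspec (not_lt.2 ht)
  · have hmin := Nat.find_min hex (m := n) (by omega)
    rw [h] at hspec
    have hhalf : δ n / 2 = δ (n + 1) := by simp only [hδ, pow_succ]; ring
    refine ⟨w n, δ n, w (n + 1), hδpos n, ?_, hxmem n, ?_, ?_, not_lt.1 hmin, hhalf ▸ hspec⟩
    · have := hp1 n
      simp only [hδ]; nlinarith
    · refine Metric.closedBall_subset_closedBall' ?_
      have : |w n - c₀| ≤ (1 - (1 / 2) ^ n) * R := by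
        have := hp1 n
        rw [abs_le]
        constructor <;> simp only [hw] <;> nlinarith
      rw [Real.dist_eq]
      simp only [hδ] at this ⊢
      linarith
    · refine Metric.closedBall_subset_closedBall' ?_
      have : |w (n + 1) - w n| ≤ δ n / 2 := by
        have := hp n
        rw [abs_le]
        constructor <;> simp only [hw, hδ, pow_succ] <;> nlinarith
      rw [Real.dist_eq]
      linarith

/-- Take Vitali-disjoint stopping balls `B` of radius `r`, with half-size subballs `B'` of length
`r`. The enlargements `5B` cover almost all of `{f > t}` in the interval, and each contributes at
most `C * 10r = 10C |B'|` to the integral of `(f - t)⁺`. The `B'` are disjoint, and `f > t - C`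
almost everywhere on them. Chebyshev at height `20C` then gives the factor one half. -/
lemma measure_superlevel_le_half {f : ℝ → ℝ} (hf : LocallyIntegrable f) {C : ℝ} (hC0 : 0 < C)
    (hC : ∀ a b : ℝ, a < b → ∀ᵐ x ∂volume.restrict (Icc a b), ⨍ t in Icc a b, f t ≤ f x + C)
    {a b t : ℝ} (hab : a < b) (ht : ⨍ x in Icc a b, f x ≤ t) :
    volume.restrict (Icc a b) {x | t + 20 * C < f x} ≤
      2⁻¹ * volume.restrict (Icc a b) {x | t - 2 * C < f x} := by
  set c₀ := (a + b) / 2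
  set R := (b - a) / 2
  have hR : 0 < R := by simp only [R]; linarith
  have hI : Icc a b = Metric.closedBall c₀ R := by
    rw [Real.closedBall_eq_Icc]; congr 1 <;> simp only [c₀, R] <;> ring
  rw [hI] at ht ⊢
  set S : Set (ℝ × ℝ × ℝ) := {p | 0 < p.2.1 ∧ p.2.1 ≤ R ∧
    Metric.closedBall p.1 p.2.1 ⊆ Metric.closedBall c₀ R ∧
    Metric.closedBall p.2.2 (p.2.1 / 2) ⊆ Metric.closedBall p.1 p.2.1 ∧
    ⨍ y in Metric.closedBall p.1 p.2.1, f y ≤ t ∧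
    t < ⨍ y in Metric.closedBall p.2.2 (p.2.1 / 2), f y} with hS
  obtain ⟨u, huS, hucount, hdisj, hcov⟩ := exists_countable_disjoint_closedBall_covering S
    (fun p => p.1) (fun p => p.2.1) R (fun p hp => hp.1) (fun p hp => hp.2.1)
  have hdisj' : u.PairwiseDisjoint fun p => Metric.closedBall p.2.2 (p.2.1 / 2) :=
    fun p hp q hq hpq => (hdisj hp hq hpq).mono (huS hp).2.2.2.1 (huS hq).2.2.2.1
  have hlow : volume (⋃ p ∈ u, Metric.closedBall p.2.2 (p.2.1 / 2)) ≤
      volume.restrict (Metric.closedBall c₀ R) {x | t - 2 * C < f x} := by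
    rw [Measure.restrict_apply' Metric.isClosed_closedBall.measurableSet]
    refine measure_mono_ae ?_
    have hae : ∀ p ∈ u, ∀ᵐ x, x ∈ Metric.closedBall p.2.2 (p.2.1 / 2) → t - 2 * C < f x := by
      intro p hp
      have hpS := huS hp
      rw [← ae_restrict_iff' Metric.isClosed_closedBall.measurableSet]
      have hlt : p.2.2 - p.2.1 / 2 < p.2.2 + p.2.1 / 2 := by linarith [hpS.1]
      have h1 := hpS.2.2.2.2.2
      rw [Real.closedBall_eq_Icc] at h1 ⊢
      filter_upwards [hC _ _ hlt] with x hx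
      linarith
    filter_upwards [(ae_ball_iff hucount).2 hae] with x hx hxU
    obtain ⟨p, hp, hxp⟩ := mem_iUnion₂.1 hxU
    exact ⟨hx p hp hxp, (huS hp).2.2.1 ((huS hp).2.2.2.1 hxp)⟩
  have hup : ∫⁻ x in Metric.closedBall c₀ R, ENNReal.ofReal (f x - t) ≤
      ENNReal.ofReal (10 * C) * volume (⋃ p ∈ u, Metric.closedBall p.2.2 (p.2.1 / 2)) := by
    have := hucount.to_subtype
    calc ∫⁻ x in Metric.closedBall c₀ R, ENNReal.ofReal (f x - t)
        = ∫⁻ x, (Metric.closedBall c₀ R).indicator (fun x => ENNReal.ofReal (f x - t)) x :=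
          (lintegral_indicator Metric.isClosed_closedBall.measurableSet _).symm
      _ ≤ ∫⁻ x, (⋃ p : u, Metric.closedBall p.1.1 (5 * p.1.2.1)).indicator
            (fun x => ENNReal.ofReal (f x - t)) x := by
          refine lintegral_mono_ae ?_
          filter_upwards [ae_exists_stopping_ball hf hR ht] with x hx
          by_cases hxI : x ∈ Metric.closedBall c₀ R
          · rcases lt_or_ge t (f x) with hxt | hxt
            · obtain ⟨c, r, c', hr, hrR, hxc, hsub, hsub', h1, h2⟩ := hx hxI hxt
              obtain ⟨q, hq, hqsub⟩ := hcov (c, r, c') ⟨hr, hrR, hsub, hsub', h1, h2⟩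
              rw [indicator_of_mem hxI, indicator_of_mem (mem_iUnion.2 ⟨⟨q, hq⟩, hqsub hxc⟩)]
            · rw [indicator_of_mem hxI, ENNReal.ofReal_of_nonpos (by linarith)]
              exact zero_le
          · rw [indicator_of_notMem hxI]
            exact zero_le
      _ = ∫⁻ x in ⋃ p : u, Metric.closedBall p.1.1 (5 * p.1.2.1), ENNReal.ofReal (f x - t) :=
          lintegral_indicator
            (MeasurableSet.iUnion fun p => Metric.isClosed_closedBall.measurableSet) _
      _ ≤ ∑' p : u, ∫⁻ x in Metric.closedBall p.1.1 (5 * p.1.2.1), ENNReal.ofReal (f x - t) :=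
          lintegral_iUnion_le _ _
      _ ≤ ∑' p : u, ENNReal.ofReal (10 * C) *
            volume (Metric.closedBall p.1.2.2 (p.1.2.1 / 2)) := by
          refine ENNReal.tsum_le_tsum fun p => ?_
          obtain ⟨hr, -, -, -, h1, -⟩ := huS p.2
          rw [Real.closedBall_eq_Icc] at h1
          rw [Real.closedBall_eq_Icc, Real.volume_closedBall, ← ENNReal.ofReal_mul (by positivity)]
          refine (lintegral_ofReal_sub_le hf hC (by linarith) (by linarith) (by linarith) h1).trans
            (ENNReal.ofReal_le_ofReal (le_of_eq (by ring)))
      _ = _ := by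
          rw [ENNReal.tsum_mul_left, measure_biUnion hucount hdisj'
            fun p _ => Metric.isClosed_closedBall.measurableSet]
  set D := volume.restrict (Metric.closedBall c₀ R) {x | t + 20 * C < f x} with hD
  have hcheb : ENNReal.ofReal (20 * C) * D ≤
      ∫⁻ x in Metric.closedBall c₀ R, ENNReal.ofReal (f x - t) := by
    refine le_trans ?_ (mul_meas_ge_le_lintegral₀ ?_ (ENNReal.ofReal (20 * C)))
    · gcongr
      refine measure_mono fun x hx => ENNReal.ofReal_le_ofReal ?_
      simp only [mem_ofPred_eq] at hx
      linarith
    · exact (hf.aestronglyMeasurable.aemeasurable.sub_const t).ennreal_ofReal.restrict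
  have h10 : ENNReal.ofReal (20 * C) = ENNReal.ofReal (10 * C) * 2 := by
    rw [← ENNReal.ofReal_ofNat, ← ENNReal.ofReal_mul (by positivity)]
    congr 1; ring
  have hfin := hcheb.trans (hup.trans (mul_le_mul_right hlow _))
  rw [h10, mul_assoc, ENNReal.mul_le_mul_iff_right (by simpa using hC0) ENNReal.ofReal_ne_top]
    at hfin
  rw [mul_comm, ← div_eq_mul_inv, ENNReal.le_div_iff_mul_le (by simp) (by simp), mul_comm]
  exact hfin

/-- John-Nirenberg for `BLO`. -/
lemma IsBLO.exists_isA1_exp {f : ℝ → ℝ} (hf : IsBLO f) :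
    ∃ μ : ℝ, 0 < μ ∧ IsA1 (fun x => Real.exp (f x / μ)) := by
  obtain ⟨C, hC0, hC⟩ := hf.exists_setAverage_le
  have hlog : 0 < Real.log (3 / 2) := Real.log_pos (by norm_num)
  -- Raising the level by `20C + 2C = 22C` halves the measure and multiplies `e^{ε f}` by `3/2 < 2`.
  set ε := Real.log (3 / 2) / (22 * C) with hε
  have hε0 : 0 < ε := by positivity
  obtain ⟨B, hB, hBint⟩ := exists_lintegral_le_of_geometric_tail (A := 1)
    (ρ := ENNReal.ofReal (3 / 2)) ENNReal.one_ne_top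
    (by rw [ENNReal.one_lt_ofReal]; norm_num)
    (by rw [← ENNReal.ofReal_ofNat 2, ENNReal.ofReal_lt_ofReal_iff] <;> norm_num)
  refine ⟨ε⁻¹, by positivity, ?_⟩
  simp only [div_inv_eq_mul]
  refine isA1_exp_of_lintegral_le (hf.1.aestronglyMeasurable.aemeasurable.mul_const ε) hB ?_
  intro a b hab
  set m := ⨍ t in Icc a b, f t
  have htail : ∀ n : ℕ, volume.restrict (Icc a b) {x | m + 22 * C * n - 2 * C < f x} ≤
      2⁻¹ ^ n * volume.restrict (Icc a b) univ := by
    intro n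
    induction n with
    | zero => simpa using measure_mono (μ := volume.restrict (Icc a b)) (subset_univ _)
    | succ n ih =>
      have h1 := measure_superlevel_le_half hf.1 hC0 hC hab (t := m + 22 * C * n)
        (le_add_of_nonneg_right (by positivity))
      have h2 : m + 22 * C * ((n + 1 : ℕ) : ℝ) - 2 * C = m + 22 * C * n + 20 * C := by
        push_cast; ring
      rw [h2]
      calc _ ≤ _ := h1
        _ ≤ 2⁻¹ * (2⁻¹ ^ n * volume.restrict (Icc a b) univ) := by gcongr
        _ = _ := by rw [pow_succ', mul_assoc]
  have hint := hBint (volume.restrict (Icc a b))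
    (fun x => ENNReal.ofReal (Real.exp ((f x - m + 2 * C) * ε)))
    (ae_of_all _ fun x => ENNReal.ofReal_ne_top) (fun n => by
      rw [one_mul]
      refine le_trans (measure_mono fun x hx => ?_) (htail n)
      simp only [mem_ofPred_eq] at hx ⊢
      rw [← ENNReal.ofReal_pow (by norm_num), ENNReal.ofReal_lt_ofReal_iff (Real.exp_pos _),
        ← Real.exp_log (show (0 : ℝ) < 3 / 2 by norm_num), ← Real.exp_nat_mul,
        Real.exp_lt_exp] at hx
      have h3 : Real.log (3 / 2) = 22 * C * ε := by rw [hε]; field_simp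
      rw [h3] at hx
      have : (22 * C * n) * ε < (f x - m + 2 * C) * ε := by linarith
      linarith [lt_of_mul_lt_mul_right this hε0.le])
  filter_upwards [hC a b hab] with x hx
  rw [Measure.restrict_apply_univ, Real.volume_Icc] at hint
  calc ∫⁻ t in Icc a b, ENNReal.ofReal (Real.exp (f t * ε))
      = ∫⁻ t in Icc a b, ENNReal.ofReal (Real.exp ((m - 2 * C) * ε)) *
          ENNReal.ofReal (Real.exp ((f t - m + 2 * C) * ε)) := by
        refine lintegral_congr fun t => ?_
        rw [← ENNReal.ofReal_mul (Real.exp_pos _).le, ← Real.exp_add]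
        congr 2; ring
    _ = ENNReal.ofReal (Real.exp ((m - 2 * C) * ε)) *
          ∫⁻ t in Icc a b, ENNReal.ofReal (Real.exp ((f t - m + 2 * C) * ε)) :=
        lintegral_const_mul' _ _ ENNReal.ofReal_ne_top
    _ ≤ ENNReal.ofReal (Real.exp (f x * ε)) * (B * ENNReal.ofReal (b - a)) := by
        gcongr
        linarith
    _ = _ := by ring

/-! ### The maximal function: localized weak type bound and Coifman-Rochberg. -/

lemma setLIntegral_le_hlMaximal_mul (g : ℝ → ℝ) {a b x : ℝ} (hab : a < b) (hx : x ∈ Icc a b) :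
    ∫⁻ t in Icc a b, ‖g t‖ₑ ≤ hlMaximal g x * ENNReal.ofReal (b - a) := by
  rw [← setLAverage_Icc_le_iff hab]
  exact le_iSup_of_le a (le_iSup_of_le b (le_iSup₂ (f := fun (_ : a < b) (_ : x ∈ Icc a b) =>
    ⨍⁻ t in Icc a b, ‖g t‖ₑ ∂volume) hab hx))

lemma hlMaximal_le_iff (g : ℝ → ℝ) (x : ℝ) (s : ℝ≥0∞) :
    hlMaximal g x ≤ s ↔ ∀ a b : ℝ, a < b → x ∈ Icc a b →
      ∫⁻ t in Icc a b, ‖g t‖ₑ ≤ s * ENNReal.ofReal (b - a) := by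
  simp only [hlMaximal, iSup_le_iff]
  refine forall₃_congr fun a b hab => ?_
  rw [setLAverage_Icc_le_iff hab]

/-- Localized weak type bound for the maximal function. -/
lemma mul_measure_lt_hlMaximal_le (g : ℝ → ℝ) {a b y : ℝ} (hab : a < b) (hy : y ∈ Icc a b)
    (s : ℝ≥0∞) :
    s * volume.restrict (Icc a b) {x | s < hlMaximal g x} ≤
      15 * hlMaximal g y * ENNReal.ofReal (b - a) := by
  rcases le_or_gt s (2 * hlMaximal g y) with hs | hs
  · calc s * volume.restrict (Icc a b) {x | s < hlMaximal g x}
        ≤ (15 * hlMaximal g y) * volume.restrict (Icc a b) univ := by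
          refine mul_le_mul' (hs.trans ?_) (measure_mono (subset_univ _))
          gcongr
          norm_num
      _ = _ := by rw [Measure.restrict_apply_univ, Real.volume_Icc]
  set S : Set (ℝ × ℝ) := {p | 0 < p.2 ∧ p.2 ≤ (b - a) / 2 ∧
    Metric.closedBall p.1 p.2 ⊆ Icc (a - (b - a)) (b + (b - a)) ∧
    s * ENNReal.ofReal (2 * p.2) ≤ ∫⁻ t in Metric.closedBall p.1 p.2, ‖g t‖ₑ}
  have hmem : ∀ x ∈ Icc a b, s < hlMaximal g x →
      ∃ p ∈ S, x ∈ Metric.closedBall p.1 p.2 := by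
    intro x hx hsx
    have h1 := (hlMaximal_le_iff g x s).not.1 (not_le.2 hsx)
    push Not at h1
    obtain ⟨p, q, hpq, hxpq, hlt⟩ := h1
    -- A longer interval could be enlarged, at most doubling its length, to contain `y`; its mean
    -- would then be at most `2 M g(y) < s`. So only short intervals matter, and these stay in the
    -- threefold enlargement of `[a, b]`; the Vitali factor 5 then makes 15.
    have hshort : q - p < b - a := by
      by_contra! hge
      refine absurd hlt (not_lt.2 ?_)
      have hmin : min a p < max b q := (min_le_left _ _).trans_lt (hab.trans_le (le_max_left _ _))
      have hymem : y ∈ Icc (min a p) (max b q) :=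
        ⟨(min_le_left _ _).trans hy.1, hy.2.trans (le_max_left _ _)⟩
      have hlen : max b q - min a p ≤ 2 * (q - p) := by
        rcases max_cases b q with h | h <;> rcases min_cases a p with h' | h' <;>
          linarith [hx.1, hx.2, hxpq.1, hxpq.2]
      calc ∫⁻ t in Icc p q, ‖g t‖ₑ ≤ ∫⁻ t in Icc (min a p) (max b q), ‖g t‖ₑ :=
            lintegral_mono_set (Icc_subset_Icc (min_le_right _ _) (le_max_right _ _))
        _ ≤ hlMaximal g y * ENNReal.ofReal (max b q - min a p) :=
            setLIntegral_le_hlMaximal_mul g hmin hymem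
        _ ≤ hlMaximal g y * ENNReal.ofReal (2 * (q - p)) := by gcongr
        _ = 2 * hlMaximal g y * ENNReal.ofReal (q - p) := by
            rw [ENNReal.ofReal_mul (by norm_num), ENNReal.ofReal_ofNat]; ring
        _ ≤ s * ENNReal.ofReal (q - p) := by gcongr
    have hball : Metric.closedBall ((p + q) / 2) ((q - p) / 2) = Icc p q := by
      rw [Real.closedBall_eq_Icc]; congr 1 <;> ring
    refine ⟨((p + q) / 2, (q - p) / 2), ⟨by simpa using hpq, ?_, ?_, ?_⟩, ?_⟩
    · simp only; linarith
    · simp only [hball]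
      refine Icc_subset_Icc ?_ ?_ <;> linarith [hx.1, hx.2, hxpq.1, hxpq.2]
    · simp only [hball]
      rw [mul_div_cancel₀ _ two_ne_zero]
      exact hlt.le
    · simpa only [hball] using hxpq
  obtain ⟨u, huS, hucount, hdisj, hcov⟩ := exists_countable_disjoint_closedBall_covering S
    (fun p => p.1) (fun p => p.2) ((b - a) / 2) (fun p hp => hp.1) (fun p hp => hp.2.1)
  have := hucount.to_subtype
  calc s * volume.restrict (Icc a b) {x | s < hlMaximal g x}
      ≤ s * volume (⋃ p : u, Metric.closedBall p.1.1 (5 * p.1.2)) := by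
        rw [Measure.restrict_apply' measurableSet_Icc]
        gcongr
        rintro x ⟨hsx, hxI⟩
        obtain ⟨p, hpS, hxp⟩ := hmem x hxI hsx
        obtain ⟨q, hq, hsub⟩ := hcov p hpS
        exact mem_iUnion.2 ⟨⟨q, hq⟩, hsub hxp⟩
    _ ≤ s * ∑' p : u, volume (Metric.closedBall p.1.1 (5 * p.1.2)) := by
        gcongr
        exact measure_iUnion_le _
    _ = ∑' p : u, 5 * (s * ENNReal.ofReal (2 * p.1.2)) := by
        rw [← ENNReal.tsum_mul_left]
        refine tsum_congr fun p => ?_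
        rw [Real.volume_closedBall, show 2 * (5 * p.1.2) = 5 * (2 * p.1.2) by ring,
          ENNReal.ofReal_mul (by norm_num), ENNReal.ofReal_ofNat]
        ring
    _ ≤ ∑' p : u, 5 * ∫⁻ t in Metric.closedBall p.1.1 p.1.2, ‖g t‖ₑ :=
        ENNReal.tsum_le_tsum fun p => by gcongr; exact (huS p.2).2.2.2
    _ = 5 * ∫⁻ t in ⋃ p ∈ u, Metric.closedBall p.1 p.2, ‖g t‖ₑ := by
        rw [ENNReal.tsum_mul_left, lintegral_biUnion hucount
          (fun p _ => Metric.isClosed_closedBall.measurableSet) hdisj]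
    _ ≤ 5 * ∫⁻ t in Icc (a - (b - a)) (b + (b - a)), ‖g t‖ₑ := by
        gcongr
        exact (iUnion₂_subset fun p hp => (huS hp).2.2.1)
    _ ≤ 5 * (hlMaximal g y * ENNReal.ofReal (b + (b - a) - (a - (b - a)))) := by
        gcongr
        exact setLIntegral_le_hlMaximal_mul g (by linarith)
          ⟨by linarith [hy.1], by linarith [hy.2]⟩
    _ = _ := by
        rw [show b + (b - a) - (a - (b - a)) = 3 * (b - a) by ring,
          ENNReal.ofReal_mul (by norm_num), ENNReal.ofReal_ofNat]
        ring

/-- Coifman-Rochberg: powers `(M g) ^ δ` with `δ < 1` are `A₁` weights. -/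
lemma exists_lintegral_hlMaximal_rpow_le {δ : ℝ} (hδ0 : 0 < δ) (hδ1 : δ < 1) :
    ∃ B : ℝ≥0∞, B ≠ ⊤ ∧ ∀ g : ℝ → ℝ, (∀ᵐ x, hlMaximal g x ≠ ⊤) → ∀ a b y : ℝ, a < b →
      y ∈ Icc a b → hlMaximal g y ≠ 0 → hlMaximal g y ≠ ⊤ →
      ∫⁻ x in Icc a b, hlMaximal g x ^ δ ≤ B * hlMaximal g y ^ δ * ENNReal.ofReal (b - a) := by
  have hρ1 : (1 : ℝ≥0∞) < 2 ^ δ := ENNReal.one_lt_rpow (by norm_num) hδ0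
  -- This is where `δ < 1` enters: `(M g)^δ` grows by `2^δ` between the levels `2ⁿ m`, while the
  -- weak type bound halves the measure.
  have hρ2 : (2 : ℝ≥0∞) ^ δ < 2 := by
    conv_rhs => rw [← ENNReal.rpow_one 2]
    exact ENNReal.rpow_lt_rpow_of_exponent_lt (by norm_num) (by norm_num) hδ1
  obtain ⟨B, hB, hBint⟩ := exists_lintegral_le_of_geometric_tail (A := 15) (by norm_num) hρ1 hρ2
  refine ⟨B, hB, fun g hg a b y hab hy hm0 hmt => ?_⟩
  set m := hlMaximal g y
  have hmδ0 : m ^ δ ≠ 0 := (ENNReal.rpow_pos (pos_iff_ne_zero.2 hm0) hmt).ne'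
  have hmδt : m ^ δ ≠ ⊤ := ENNReal.rpow_ne_top_of_nonneg hδ0.le hmt
  have hint := hBint (volume.restrict (Icc a b)) (fun x => (hlMaximal g x / m) ^ δ)
    (by
      filter_upwards [ae_restrict_of_ae hg] with x hx
      exact ENNReal.rpow_ne_top_of_nonneg hδ0.le (ENNReal.div_ne_top hx hm0))
    (fun n => by
      have hset : {x | ((2 : ℝ≥0∞) ^ δ) ^ n < (hlMaximal g x / m) ^ δ} =
          {x | 2 ^ n * m < hlMaximal g x} := by
        ext x
        simp only [mem_ofPred_eq]
        rw [← ENNReal.rpow_natCast, ← ENNReal.rpow_mul, mul_comm δ, ENNReal.rpow_mul,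
          ENNReal.rpow_natCast, ENNReal.rpow_lt_rpow_iff hδ0,
          ENNReal.lt_div_iff_mul_lt (Or.inl hm0) (Or.inl hmt)]
      rw [hset, Measure.restrict_apply_univ, Real.volume_Icc]
      have h := mul_measure_lt_hlMaximal_le g hab hy (2 ^ n * m)
      have h' : m * (2 ^ n * volume.restrict (Icc a b) {x | 2 ^ n * m < hlMaximal g x}) ≤
          m * (15 * ENNReal.ofReal (b - a)) := by
        calc _ = 2 ^ n * m * volume.restrict (Icc a b) {x | 2 ^ n * m < hlMaximal g x} := by
              rw [mul_left_comm, mul_assoc]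
          _ ≤ _ := h
          _ = _ := by ring
      rw [ENNReal.mul_le_mul_iff_right hm0 hmt] at h'
      have h2 : (2 : ℝ≥0∞) ^ n ≠ 0 := by simp
      have h2t : (2 : ℝ≥0∞) ^ n ≠ ⊤ := by simp
      rw [mul_comm, ← ENNReal.le_div_iff_mul_le (Or.inl h2) (Or.inl h2t)] at h'
      refine h'.trans (le_of_eq ?_)
      rw [div_eq_mul_inv, ENNReal.inv_pow]
      ring)
  rw [Measure.restrict_apply_univ, Real.volume_Icc] at hint
  calc ∫⁻ x in Icc a b, hlMaximal g x ^ δ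
      = ∫⁻ x in Icc a b, m ^ δ * (hlMaximal g x / m) ^ δ := by
        refine lintegral_congr fun x => ?_
        rw [← ENNReal.mul_rpow_of_nonneg _ _ hδ0.le, ENNReal.mul_div_cancel hm0 hmt]
    _ = m ^ δ * ∫⁻ x in Icc a b, (hlMaximal g x / m) ^ δ := lintegral_const_mul' _ _ hmδt
    _ ≤ m ^ δ * (B * ENNReal.ofReal (b - a)) := by gcongr
    _ = _ := by ring

/-! ### Measurability of the maximal function and comparison with an `A₁` weight. -/

/-- Any interval sits in rational ones of arbitrarily close length. The reduction to countably many
intervals yields measurability and lets exceptional null sets be united. -/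
lemma hlMaximal_le_of_forall_rat {g : ℝ → ℝ} {x : ℝ} {s : ℝ≥0∞}
    (h : ∀ p q : ℚ, (p : ℝ) < q → x ∈ Icc (p : ℝ) q →
      ∫⁻ t in Icc (p : ℝ) q, ‖g t‖ₑ ≤ s * ENNReal.ofReal (q - p)) : hlMaximal g x ≤ s := by
  rw [hlMaximal_le_iff]
  intro a b hab hx
  rcases eq_or_ne s ⊤ with rfl | hs
  · rw [ENNReal.top_mul (by simpa using hab)]
    exact le_top
  have hlim : Filter.Tendsto (fun ε : ℝ => s * ENNReal.ofReal (b - a + 2 * ε))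
      (nhdsWithin 0 (Ioi 0)) (nhds (s * ENNReal.ofReal (b - a))) := by
    refine ENNReal.Tendsto.const_mul ?_ (Or.inr hs)
    have : Continuous fun ε : ℝ => ENNReal.ofReal (b - a + 2 * ε) :=
      ENNReal.continuous_ofReal.comp (by fun_prop)
    simpa using (this.tendsto 0).mono_left nhdsWithin_le_nhds
  refine ge_of_tendsto hlim ?_
  filter_upwards [self_mem_nhdsWithin] with ε hε
  have hε' : 0 < ε := hε
  obtain ⟨p, hp1, hp2⟩ := exists_rat_btwn (show a - ε < a by linarith)
  obtain ⟨q, hq1, hq2⟩ := exists_rat_btwn (show b < b + ε by linarith)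
  calc ∫⁻ t in Icc a b, ‖g t‖ₑ ≤ ∫⁻ t in Icc (p : ℝ) q, ‖g t‖ₑ :=
        lintegral_mono_set (Icc_subset_Icc hp2.le hq1.le)
    _ ≤ s * ENNReal.ofReal (q - p) :=
        h p q (by linarith) ⟨hp2.le.trans hx.1, hx.2.trans hq1.le⟩
    _ ≤ _ := by
        gcongr
        linarith

lemma measurable_hlMaximal (g : ℝ → ℝ) : Measurable (hlMaximal g) := by
  have h : hlMaximal g = fun x => ⨆ (p : ℚ) (q : ℚ) (_ : (p : ℝ) < q),
      (Icc (p : ℝ) q).indicator (fun _ => ⨍⁻ t in Icc (p : ℝ) q, ‖g t‖ₑ ∂volume) x := by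
    ext x
    refine le_antisymm (hlMaximal_le_of_forall_rat fun p q hpq hx => ?_) ?_
    · rw [← setLAverage_Icc_le_iff hpq]
      refine le_iSup_of_le p (le_iSup_of_le q ?_)
      rw [iSup_pos hpq, indicator_of_mem hx]
    · refine iSup_le fun p => iSup_le fun q => iSup_le fun hpq => ?_
      by_cases hx : x ∈ Icc (p : ℝ) q
      · rw [indicator_of_mem hx, setLAverage_Icc_le_iff hpq]
        exact setLIntegral_le_hlMaximal_mul g hpq hx
      · rw [indicator_of_notMem hx]
        exact zero_le
  rw [h]
  exact Measurable.iSup fun p => Measurable.iSup fun q => Measurable.iSup fun _ =>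
    measurable_const.indicator measurableSet_Icc

lemma ae_enorm_le_hlMaximal {g : ℝ → ℝ} (hg : LocallyIntegrable g) :
    ∀ᵐ x, ‖g x‖ₑ ≤ hlMaximal g x := by
  filter_upwards [IsUnifLocDoublingMeasure.ae_tendsto_average volume hg 1] with x hx
  have hlim : Filter.Tendsto (fun δ : ℝ => δ) (nhdsWithin 0 (Ioi 0)) (nhdsWithin 0 (Ioi 0)) :=
    Filter.tendsto_id
  have hpos : ∀ᶠ δ : ℝ in nhdsWithin 0 (Ioi 0), 0 < δ := self_mem_nhdsWithin
  have h := (hx (fun _ => x) (fun δ => δ) hlim (hpos.mono fun δ hδ => by simpa using hδ.le)).enorm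
  refine le_of_tendsto h ?_
  filter_upwards [hpos] with δ hδ
  rw [Real.closedBall_eq_Icc]
  refine (enorm_integral_le_lintegral_enorm _).trans ?_
  exact (setLAverage_Icc_le_iff (by linarith) _ _).2
    (setLIntegral_le_hlMaximal_mul g (by linarith) ⟨by linarith, by linarith⟩)

lemma IsA1.exists_hlMaximal_le {w : ℝ → ℝ} (hw : IsA1 w) :
    ∃ K : ℝ≥0∞, K ≠ ⊤ ∧ ∀ᵐ x, hlMaximal w x ≤ K * ENNReal.ofReal (w x) := by
  obtain ⟨K, hK, h⟩ := hw.exists_setLAverage_le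
  refine ⟨K, hK, ?_⟩
  have hae : ∀ᵐ x, ∀ p q : ℚ, (p : ℝ) < q → x ∈ Icc (p : ℝ) q →
      ⨍⁻ t in Icc (p : ℝ) q, ENNReal.ofReal (w t) ∂volume ≤ K * ENNReal.ofReal (w x) := by
    simp only [ae_all_iff]
    intro p q hpq
    exact (ae_restrict_iff' measurableSet_Icc).1 (h p q hpq)
  filter_upwards [hae] with x hx
  refine hlMaximal_le_of_forall_rat fun p q hpq hxI => ?_
  simp only [Real.enorm_of_nonneg (hw.nonneg _)]
  exact (setLAverage_Icc_le_iff hpq _ _).1 (hx p q hpq hxI)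

/-! ### Passing between `A₁` exponents and decompositions. -/

/-- Taking logarithms in `w ≤ M w ≤ K w` puts `h = f - μ log (M w)` between `-μ log K` and `0`. -/
lemma IsA1.exists_isLogMaximalDecomp {f : ℝ → ℝ} (hf : AEMeasurable f) {μ : ℝ} (hμ : 0 < μ)
    (hw : IsA1 (fun x => Real.exp (f x / μ))) :
    ∃ h : ℝ → ℝ, MemLp h ⊤ volume ∧
      IsLogMaximalDecomp (f - h) μ 0 (fun x => Real.exp (f x / μ)) := by
  set w : ℝ → ℝ := fun x => Real.exp (f x / μ) with hwdef
  obtain ⟨K, hK, hKle⟩ := hw.exists_hlMaximal_le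
  have hbd : ∀ᵐ x, 0 < (hlMaximal w x).toReal ∧ w x ≤ (hlMaximal w x).toReal ∧
      (hlMaximal w x).toReal ≤ K.toReal * w x := by
    filter_upwards [hKle, ae_enorm_le_hlMaximal hw.locallyIntegrable] with x h1 h2
    have hwx : 0 < w x := Real.exp_pos _
    have hKw : K * ENNReal.ofReal (w x) ≠ ⊤ := ENNReal.mul_ne_top hK ENNReal.ofReal_ne_top
    rw [Real.enorm_of_nonneg hwx.le] at h2
    have h3 := (ENNReal.ofReal_le_iff_le_toReal (ne_top_of_le_ne_top hKw h1)).1 h2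
    refine ⟨hwx.trans_le h3, h3, ?_⟩
    have h4 := ENNReal.toReal_mono hKw h1
    rwa [ENNReal.toReal_mul, ENNReal.toReal_ofReal hwx.le] at h4
  refine ⟨fun x => f x - μ * Real.log (hlMaximal w x).toReal, ?_, hμ, MemLp.zero,
    hw.locallyIntegrable, ?_⟩
  · refine memLp_top_of_bound (C := μ * Real.log K.toReal) ?_ ?_
    · exact (hf.sub ((Real.measurable_log.comp
        (measurable_hlMaximal w).ennreal_toReal).const_mul μ).aemeasurable).aestronglyMeasurable
    · filter_upwards [hbd] with x ⟨hT, h1, h2⟩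
      have hwx : 0 < w x := Real.exp_pos _
      have hKpos : 0 < K.toReal := pos_of_mul_pos_left (hT.trans_le h2) hwx.le
      have hlw : Real.log (w x) = f x / μ := Real.log_exp _
      have h3 := Real.log_le_log hwx h1
      have h4 := Real.log_le_log hT h2
      rw [Real.log_mul hKpos.ne' hwx.ne'] at h4
      rw [hlw] at h3 h4
      have hfx : f x = μ * (f x / μ) := by field_simp
      have h5 := mul_le_mul_of_nonneg_left h3 hμ.le
      have h6 := mul_le_mul_of_nonneg_left h4 hμ.le
      rw [mul_add] at h6
      rw [Real.norm_eq_abs, abs_le]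
      constructor <;> linarith
  · filter_upwards [hbd] with x ⟨hT, _, _⟩
    rw [ENNReal.log_pos_real' hT]
    simp [← EReal.coe_mul]

/-- Since `f/μ = (α/μ) log (M g) + (b + h)/μ`, the weight equals `(M g)^{α/μ}` up to factors
`e^{±N/μ}`, where `N` bounds `|b + h|`. -/
lemma IsLogMaximalDecomp.isA1_exp_div {f h : ℝ → ℝ} (hf : AEMeasurable f) (hh : MemLp h ⊤ volume)
    {α : ℝ} {b g : ℝ → ℝ} (hd : IsLogMaximalDecomp (f - h) α b g) {μ : ℝ} (hμ : α < μ) :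
    IsA1 (fun x => Real.exp (f x / μ)) := by
  have hα := hd.pos
  have hμ0 : 0 < μ := hα.trans hμ
  set δ := α / μ with hδ
  have hδ0 : 0 < δ := by positivity
  have hδ1 : δ < 1 := (div_lt_one hμ0).2 hμ
  obtain ⟨B, hB, hBint⟩ := exists_lintegral_hlMaximal_rpow_le hδ0 hδ1
  obtain ⟨N, hN⟩ : ∃ N : ℝ, ∀ᵐ x, |b x + h x| ≤ N := by
    have hbh := hd.memLp.add hh
    refine ⟨(eLpNorm (b + h) ⊤ volume).toReal, ?_⟩
    rw [eLpNorm_exponent_top]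
    filter_upwards [ae_le_eLpNormEssSup (f := b + h) (μ := volume)] with x hx
    have h1 := ENNReal.toReal_mono (by simpa using hbh.2.ne) hx
    simpa using h1
  have hae : ∀ᵐ x, hlMaximal g x ≠ 0 ∧ hlMaximal g x ≠ ⊤ ∧
      ENNReal.ofReal (Real.exp (f x / μ)) ≤
        ENNReal.ofReal (Real.exp (N / μ)) * hlMaximal g x ^ δ ∧
      hlMaximal g x ^ δ ≤
        ENNReal.ofReal (Real.exp (N / μ)) * ENNReal.ofReal (Real.exp (f x / μ)) := by
    filter_upwards [hN, hd.ae_eq] with x hNx hx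
    have h0 : hlMaximal g x ≠ 0 := by
      intro h0
      rw [h0, ENNReal.log_zero, EReal.coe_mul_bot_of_pos hα, EReal.bot_add] at hx
      exact EReal.coe_ne_bot _ hx
    have ht : hlMaximal g x ≠ ⊤ := by
      intro ht
      rw [ht, ENNReal.log_top, EReal.coe_mul_top_of_pos hα, EReal.top_add_coe] at hx
      exact EReal.coe_ne_top _ hx
    have hT : 0 < (hlMaximal g x).toReal := ENNReal.toReal_pos h0 ht
    rw [ENNReal.log_pos_real' hT, ← EReal.coe_mul, ← EReal.coe_add, EReal.coe_eq_coe_iff,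
      Pi.sub_apply] at hx
    have hpow : hlMaximal g x ^ δ =
        ENNReal.ofReal (Real.exp (Real.log (hlMaximal g x).toReal * δ)) := by
      rw [← Real.rpow_def_of_pos hT, ← ENNReal.ofReal_rpow_of_pos hT, ENNReal.ofReal_toReal ht]
    have hfx : f x / μ = Real.log (hlMaximal g x).toReal * δ + (b x + h x) / μ := by
      rw [hδ]; field_simp; linarith
    obtain ⟨hN1, hN2⟩ := abs_le.1 hNx
    have hN1' := div_le_div_of_nonneg_right hN1 hμ0.le
    have hN2' := div_le_div_of_nonneg_right hN2 hμ0.le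
    rw [neg_div] at hN1'
    refine ⟨h0, ht, ?_, ?_⟩ <;>
    · rw [hpow, ← ENNReal.ofReal_mul (Real.exp_pos _).le, ← Real.exp_add]
      refine ENNReal.ofReal_le_ofReal (Real.exp_le_exp.2 ?_)
      linarith
  set E := ENNReal.ofReal (Real.exp (N / μ))
  refine isA1_exp_of_lintegral_le (K := E * (B * E)) (hf.div_const μ) ?_ ?_
  · exact ENNReal.mul_ne_top ENNReal.ofReal_ne_top (ENNReal.mul_ne_top hB ENNReal.ofReal_ne_top)
  · intro p q hpq
    filter_upwards [ae_restrict_of_ae hae, ae_restrict_mem measurableSet_Icc]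
      with y ⟨h0, ht, _, hy⟩ hyI
    calc ∫⁻ t in Icc p q, ENNReal.ofReal (Real.exp (f t / μ))
        ≤ ∫⁻ t in Icc p q, E * hlMaximal g t ^ δ :=
          lintegral_mono_ae ((ae_restrict_of_ae hae).mono fun t ht => ht.2.2.1)
      _ = E * ∫⁻ t in Icc p q, hlMaximal g t ^ δ :=
          lintegral_const_mul' _ _ ENNReal.ofReal_ne_top
      _ ≤ E * (B * hlMaximal g y ^ δ * ENNReal.ofReal (q - p)) := by
          gcongr
          exact hBint g (hae.mono fun t ht => ht.2.1) p q y hpq hyI h0 ht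
      _ ≤ E * (B * (E * ENNReal.ofReal (Real.exp (f y / μ))) * ENNReal.ofReal (q - p)) := by
          gcongr
      _ = _ := by ring

theorem mainTheorem1 (f : ℝ → ℝ) (hf : IsBLO f) :
    distNewLinfty f = sigmaA1 f ∧ sigmaA1 f < ⊤ := by
  have hfm : AEMeasurable f := hf.1.aestronglyMeasurable.aemeasurable
  refine ⟨le_antisymm ?_ ?_, ?_⟩
  · refine le_iInf fun μ => le_iInf fun hμ => le_iInf fun hw => ?_
    obtain ⟨h, hh, hd⟩ := hw.exists_isLogMaximalDecomp hfm hμ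
    refine iInf₂_le_of_le h hh (iInf₂_le_of_le μ 0 (iInf₂_le_of_le _ hd ?_))
    simp
  -- The term `‖b‖_∞` is discarded: `σ(f) ≤ α` already holds for every decomposition, as the limit
  -- of `σ(f) ≤ μ` for `μ > α`.
  · refine le_iInf fun h => le_iInf fun hh => le_iInf fun α => le_iInf fun b =>
      le_iInf fun g => le_iInf fun hd => le_trans ?_ le_self_add
    have hα := hd.pos
    have hlim : Filter.Tendsto (fun μ : ℝ => ENNReal.ofReal μ) (nhdsWithin α (Ioi α))
        (nhds (ENNReal.ofReal α)) :=
      (ENNReal.continuous_ofReal.tendsto α).mono_left nhdsWithin_le_nhds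
    refine ge_of_tendsto hlim ?_
    filter_upwards [self_mem_nhdsWithin] with μ hμ
    exact iInf₂_le_of_le μ (hα.trans hμ) (iInf_le_of_le (hd.isA1_exp_div hfm hh hμ) le_rfl)
  · obtain ⟨μ, hμ, hw⟩ := hf.exists_isA1_exp
    exact (iInf₂_le_of_le μ hμ (iInf_le_of_le hw le_rfl)).trans_lt ENNReal.ofReal_lt_top
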